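/- Let $G$ be a countable discrete group acting by graph automorphisms on a finite directed graph $E=(E^0,E^1,r,d)$ with range map $r$ and source map $d$, such that $E$ has no sources, i.e. $r^{-1}(x)\neq\emptyset$ for every vertex $x\in E^0$. Let $\varphi:G\times E^1\to G$ satisfy $\varphi(gh,e)=\varphi(g,he)\,\varphi(h,e)$ and $\varphi(g,e)x=gx$ for all $g,h\in G$, $e\in E^1$, $x\in E^0$. Let $E^*$ be the set of finite paths $\alpha=\alpha_1\cdots\alpha_n$ with $n\ge 0$ and $d(\alpha_i)=r(\alpha_{i+1})$; the paths of length $0$ are the vertices. Extend the action and $\varphi$ to $E^*$ by $\varphi(g,x)=g$ for $x\in E^0$, $g(\alpha\beta)=(g\alpha)(\varphi(g,\alpha)\beta)$ and $\varphi(g,\alpha\beta)=\varphi(\varphi(g,\alpha),\beta)$. Let $$\mathcal S_{G,E}=\{(\alpha,g,\beta)\in E^*\times G\times E^*: d(\alpha)=g\,d(\beta)\}\cup\{0\}$$ be the inverse semigroup with zero in which $(\alpha,g,\beta)^*=(\beta,g^{-1},\alpha)$ and $$(\alpha,g,\beta)(\gamma,h,\delta)=\begin{cases}(\alpha\, g\varepsilon,\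 \varphi(g,\varepsilon)h,\ \delta) & \text{if }\gamma=\beta\varepsilon,\\ (\alpha,\ g\,\varphi(h^{-1},\varepsilon)^{-1},\ \delta\, h^{-1}\varepsilon) & \text{if }\beta=\gamma\varepsilon,\\ 0 & \text{otherwise.}\end{cases}$$ Let $\mathcal E$ be the semilattice of idempotents of $\mathcal S_{G,E}$, ordered by $e\le f\iff ef=e$. A filter in $\mathcal E$ is a nonempty, upward closed subset of $\mathcal E\setminus\{0\}$ that is closed under products. A filter $F$ is tight if, for all finite $X\subseteq F$, finite $Y\subseteq\mathcal E\setminus F$ and finite $Z\subseteq\mathcal E^{X,Y}:=\{z\in\mathcal E: z\le x\ \forall x\in X,\ zy=0\ \forall y\in Y\}$ such that every nonzero $w\in\mathcal E^{X,Y}$ satisfies $zw\ne0$ for some $z\in Z$, one has $Z\cap F\neq\emptyset$. The set of tight filters carries the topology of pointwise convergence of characteristic functions. Each $s\in\mathcal S_{G,E}$ acts on it by the partial homeomorphism $F\mapsto\{e\in\mathcal E: s^*es\in F\}$ with domain $D_{s^*s}=\{F: s^*s\in F\}$. Let $\mathcal G_{\text{tight}}(\mathcal S_{G,E})$ be the groupoid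 of germs of this action: its elements are the classes $[s,F]$ with $s\in\mathcal S_{G,E}$ and $F\in D_{s^*s}$, where $[s,F]=[t,F']$ if and only if $F=F'$ and $se=te$ for some $e\in F$. Its topology has as a basis the sets $\{[s,F]:F\in U\}$, with $s\in\mathcal S_{G,E}$ and $U\subseteq D_{s^*s}$ open. A path $\alpha\in E^*$ is strongly fixed by $g\in G$ if $g\alpha=\alpha$ and $\varphi(g,\alpha)=1$; it is a minimal strongly fixed path for $g$ if, in addition, no proper prefix of $\alpha$ (vertices included) is strongly fixed by $g$. Theorem 12.2. The following are equivalent: (a) for every $g\in G$ there are at most finitely many minimal strongly fixed paths for $g$; (b) $\mathcal G_{\text{tight}}(\mathcal S_{G,E})$ is Hausdorff. -/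

import Mathlib

/-! ## Directed graphs and finite paths -/

/-- A directed graph with vertex set `V` and edge set `Ed`, given by its range map `r` and its
source (domain) map `d`. -/
structure DirectedGraph (V Ed : Type*) where
  r : Ed → V
  d : Ed → V

namespace DirectedGraph

variable {V Ed : Type*}

/-- `E.IsPathFrom x [e₁, …, eₙ]`: one has `r e₁ = x` and `d eᵢ = r eᵢ₊₁` for all `i`. The empty
list is a path from `x` (the vertex `x` itself). -/
def IsPathFrom (E : DirectedGraph V Ed) : V → List Ed → Prop
  | _, [] => True
  | x, e :: l => E.r e = x ∧ E.IsPathFrom (E.d e) l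

/-- The source of the path with range `x` and list of edges `l`: it is `x` for the path of length
zero, and the source of the last edge otherwise. -/
def sourceFrom (E : DirectedGraph V Ed) : V → List Ed → V
  | x, [] => x
  | _, e :: l => E.sourceFrom (E.d e) l

theorem isPathFrom_append (E : DirectedGraph V Ed) (l m : List Ed) : ∀ x,
    E.IsPathFrom x (l ++ m) ↔ E.IsPathFrom x l ∧ E.IsPathFrom (E.sourceFrom x l) m := by
  induction l with
  | nil => intro x; simp [IsPathFrom, sourceFrom]
  | cons e l ih => intro x; simp [IsPathFrom, sourceFrom, ih, and_assoc]

theorem sourceFrom_append (E : DirectedGraph V Ed) (l m : List Ed) : ∀ x,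
    E.sourceFrom x (l ++ m) = E.sourceFrom (E.sourceFrom x l) m := by
  induction l with
  | nil => intro x; rfl
  | cons e l ih => intro x; exact ih _

/-- Finite paths `e₁ e₂ … eₙ` (`n ≥ 0`) in `E`, where `d eᵢ = r eᵢ₊₁`. Paths of length zero are the
vertices. A path is recorded by its range (a vertex) and its list of edges; for `n ≥ 1` the
range is determined by the edges. -/
@[ext]
structure Path (E : DirectedGraph V Ed) where
  rng : V
  edges : List Ed
  isPath : E.IsPathFrom rng edges

namespace Path

variable {E : DirectedGraph V Ed}

/-- The source `d(α)` of a finite path. -/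
def src (α : E.Path) : V := E.sourceFrom α.rng α.edges

/-- The concatenation `αβ`, defined when `d(α) = r(β)`. -/
def comp (α β : E.Path) (h : α.src = β.rng) : E.Path where
  rng := α.rng
  edges := α.edges ++ β.edges
  isPath := (E.isPathFrom_append _ _ _).2 ⟨α.isPath, by
    have := β.isPath; rw [← h] at this; exact this⟩

/-- `α` is a prefix of `β`: there is a path `γ` with `αγ = β`. -/
def IsPrefix (α β : E.Path) : Prop :=
  ∃ (γ : E.Path) (h : α.src = γ.rng), α.comp γ h = β

/-- The (unique) path `γ` with `αγ = β`, when `α` is a prefix of `β`. -/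
noncomputable def rest {α β : E.Path} (h : α.IsPrefix β) : E.Path := h.choose

theorem src_eq_rest {α β : E.Path} (h : α.IsPrefix β) : α.src = (rest h).rng :=
  h.choose_spec.choose

theorem comp_rest {α β : E.Path} (h : α.IsPrefix β) : α.comp (rest h) (src_eq_rest h) = β :=
  h.choose_spec.choose_spec

theorem src_comp (α β : E.Path) (h : α.src = β.rng) : (α.comp β h).src = β.src := by
  simp only [src, comp, sourceFrom_append]
  rw [show E.sourceFrom α.rng α.edges = β.rng from h]

theorem src_rest {α β : E.Path} (h : α.IsPrefix β) : (rest h).src = β.src := by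
  rw [← src_comp α _ (src_eq_rest h), comp_rest h]

theorem isPrefix_iff (α β : E.Path) :
    α.IsPrefix β ↔ α.rng = β.rng ∧ α.edges <+: β.edges := by
  constructor
  · rintro ⟨γ, h, rfl⟩; exact ⟨rfl, γ.edges, rfl⟩
  · rintro ⟨h1, m, hm⟩
    have hp := β.isPath
    rw [← hm, E.isPathFrom_append, ← h1] at hp
    exact ⟨⟨α.src, m, hp.2⟩, rfl, Path.ext h1 hm⟩

theorem rng_eq_of_isPrefix {α β : E.Path} (h : α.IsPrefix β) : α.rng = β.rng :=
  ((isPrefix_iff α β).1 h).1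

theorem edges_rest {α β : E.Path} (h : α.IsPrefix β) :
    α.edges ++ (rest h).edges = β.edges := congrArg Path.edges (comp_rest h)

end Path

end DirectedGraph

/-! ## Group actions on graphs with a one-cocycle -/

/-- A directed graph `E` with vertices `V` and edges `Ed`, an action of the group `G` on `E` by
graph automorphisms (that is, actions of `G` on `V` and on `Ed` intertwined by `r` and `d`), and a
one-cocycle `φ : G × Ed → G` for the action on edges, such that `φ(g, e)` acts on
vertices as `g` does. -/
structure SelfSimilarGraph (G V Ed : Type*) [Group G] [MulAction G V] [MulAction G Ed] extends
    DirectedGraph V Ed where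
  r_smul : ∀ (g : G) (e : Ed), r (g • e) = g • r e
  d_smul : ∀ (g : G) (e : Ed), d (g • e) = g • d e
  φ : G → Ed → G
  cocycle : ∀ (g h : G) (e : Ed), φ (g * h) e = φ g (h • e) * φ h e
  φ_smul : ∀ (g : G) (e : Ed) (x : V), φ g e • x = g • x

namespace SelfSimilarGraph

variable {G V Ed : Type*} [Group G] [MulAction G V] [MulAction G Ed]
  (D : SelfSimilarGraph G V Ed)

/-- The finite paths of the underlying graph. -/
abbrev FinPath : Type _ := D.toDirectedGraph.Path

/-- The extended action on lists of edges: `g (e l) = (g e) (φ(g, e) l)`. -/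
def actEdges : G → List Ed → List Ed
  | _, [] => []
  | g, e :: l => (g • e) :: actEdges (D.φ g e) l

/-- The extended cocycle on lists of edges: `φ(g, ∅) = g` and `φ(g, e l) = φ(φ(g, e), l)`. -/
def cocEdges : G → List Ed → G
  | g, [] => g
  | g, e :: l => cocEdges (D.φ g e) l

theorem φ_one (e : Ed) : D.φ 1 e = 1 := by
  have := D.cocycle 1 1 e
  simpa using this

theorem actEdges_append (l m : List Ed) : ∀ g,
    D.actEdges g (l ++ m) = D.actEdges g l ++ D.actEdges (D.cocEdges g l) m := by
  induction l with
  | nil => intro g; rfl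
  | cons e l ih => intro g; simp [actEdges, cocEdges, ih]

theorem cocEdges_append (l m : List Ed) : ∀ g,
    D.cocEdges g (l ++ m) = D.cocEdges (D.cocEdges g l) m := by
  induction l with
  | nil => intro g; rfl
  | cons e l ih => intro g; simp [cocEdges, ih]

theorem actEdges_one (l : List Ed) : D.actEdges 1 l = l := by
  induction l with
  | nil => rfl
  | cons e l ih => simp [actEdges, φ_one, ih]

theorem cocEdges_one (l : List Ed) : D.cocEdges 1 l = 1 := by
  induction l with
  | nil => rfl
  | cons e l ih => simp [cocEdges, φ_one, ih]

theorem actEdges_mul (l : List Ed) : ∀ g h,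
    D.actEdges (g * h) l = D.actEdges g (D.actEdges h l) := by
  induction l with
  | nil => intro g h; rfl
  | cons e l ih => intro g h; simp [actEdges, mul_smul, D.cocycle, ih]

theorem cocEdges_mul (l : List Ed) : ∀ g h,
    D.cocEdges (g * h) l = D.cocEdges g (D.actEdges h l) * D.cocEdges h l := by
  induction l with
  | nil => intro g h; rfl
  | cons e l ih => intro g h; simp [actEdges, cocEdges, D.cocycle, ih]

theorem length_actEdges (l : List Ed) : ∀ g, (D.actEdges g l).length = l.length := by
  induction l with
  | nil => intro g; rfl
  | cons e l ih => intro g; simp [actEdges, ih]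

theorem cocEdges_smul (l : List Ed) : ∀ (g : G) (x : V), D.cocEdges g l • x = g • x := by
  induction l with
  | nil => intro g x; rfl
  | cons e l ih => intro g x; simp [cocEdges, ih, D.φ_smul]

theorem isPathFrom_actEdges (l : List Ed) : ∀ (g : G) (x : V),
    D.IsPathFrom x l → D.IsPathFrom (g • x) (D.actEdges g l) := by
  induction l with
  | nil => intro g x _; trivial
  | cons e l ih =>
    rintro g x ⟨h1, h2⟩
    refine ⟨by rw [D.r_smul, h1], ?_⟩
    rw [D.d_smul, ← D.φ_smul g e]
    exact ih _ _ h2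

theorem sourceFrom_actEdges (l : List Ed) : ∀ (g : G) (x : V),
    D.sourceFrom (g • x) (D.actEdges g l) = g • D.sourceFrom x l := by
  induction l with
  | nil => intro g x; rfl
  | cons e l ih =>
    intro g x
    simp only [actEdges, DirectedGraph.sourceFrom]
    rw [D.d_smul, ← D.φ_smul g e, ih, D.φ_smul]

/-- The action of `G` on finite paths: on vertices and edges it is the given action, and
`g (αβ) = (gα) (φ(g, α) β)`. -/
def act (g : G) (α : D.FinPath) : D.FinPath where
  rng := g • α.rng
  edges := D.actEdges g α.edges
  isPath := D.isPathFrom_actEdges _ _ _ α.isPath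

/-- The extension of the cocycle to finite paths: `φ(g, x) = g` on vertices, the given
one on edges, and `φ(g, αβ) = φ(φ(g, α), β)`. -/
def coc (g : G) (α : D.FinPath) : G := D.cocEdges g α.edges

theorem src_act (g : G) (α : D.FinPath) : (D.act g α).src = g • α.src :=
  D.sourceFrom_actEdges _ _ _

theorem coc_smul (g : G) (α : D.FinPath) (x : V) : D.coc g α • x = g • x :=
  D.cocEdges_smul _ _ _

/-- `α` is strongly fixed by `g`: `gα = α` and `φ(g, α) = 1`. -/
def StronglyFixed (g : G) (α : D.FinPath) : Prop :=
  D.act g α = α ∧ D.coc g α = 1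

/-- `α` is a minimal strongly fixed path for `g`: it is strongly fixed by `g`, and no proper
prefix of `α` is. -/
def MinimalStronglyFixed (g : G) (α : D.FinPath) : Prop :=
  D.StronglyFixed g α ∧ ∀ β : D.FinPath, β.IsPrefix α → β ≠ α → ¬ D.StronglyFixed g β

/-! ## The inverse semigroup of the triple -/

/-- The set `{(α, g, β) : d(α) = g d(β)} ∪ {0}`. -/
inductive InvSemigroup : Type _
  | zero : InvSemigroup
  | triple (α : D.FinPath) (g : G) (β : D.FinPath) (h : α.src = g • β.src) : InvSemigroup

namespace InvSemigroup

variable {D}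

open Classical in
/-- The multiplication: `(α, g, β)(γ, h, δ)` is
* `(α gε, φ(g, ε) h, δ)` if `γ = βε`,
* `(α, g φ(h⁻¹, ε)⁻¹, δ h⁻¹ε)` if `β = γε`,
* `0` otherwise. -/
noncomputable def mul : D.InvSemigroup → D.InvSemigroup → D.InvSemigroup
  | zero, _ => zero
  | triple _ _ _ _, zero => zero
  | triple α g β hs, triple γ h δ ht =>
    if h1 : β.IsPrefix γ then
      triple
        (α.comp (D.act g (.rest h1))
          (by rw [hs, DirectedGraph.Path.src_eq_rest h1]; rfl))
        (D.coc g (.rest h1) * h) δ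
        (by rw [DirectedGraph.Path.src_comp, src_act, DirectedGraph.Path.src_rest, ht,
              mul_smul, coc_smul])
    else if h2 : γ.IsPrefix β then
      triple α (g * (D.coc h⁻¹ (.rest h2))⁻¹)
        (δ.comp (D.act h⁻¹ (.rest h2))
          (by
            rw [show (D.act h⁻¹ (.rest h2)).rng = h⁻¹ • γ.src from by
                  rw [DirectedGraph.Path.src_eq_rest h2]; rfl, ht, inv_smul_smul]))
        (by
          rw [DirectedGraph.Path.src_comp, src_act, DirectedGraph.Path.src_rest, hs, mul_smul]
          congr 1
          rw [eq_inv_smul_iff, coc_smul])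
    else zero

/-- The adjoint `(α, g, β)* = (β, g⁻¹, α)`, `0* = 0`. -/
def adj : D.InvSemigroup → D.InvSemigroup
  | zero => zero
  | triple α g β h => triple β g⁻¹ α (by rw [h, inv_smul_smul])

end InvSemigroup

end SelfSimilarGraph

namespace SelfSimilarGraph

variable {G V Ed : Type*} [Group G] [MulAction G V] [MulAction G Ed]
  {D : SelfSimilarGraph G V Ed}

theorem cocEdges_inv (g : G) (l : List Ed) :
    D.cocEdges g⁻¹ l = (D.cocEdges g (D.actEdges g⁻¹ l))⁻¹ := by
  have := D.cocEdges_mul l g g⁻¹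
  rw [mul_inv_cancel, cocEdges_one] at this
  exact (inv_eq_of_mul_eq_one_right this.symm).symm

namespace InvSemigroup

/-- Auxiliary faithful representation by relations, used to check the inverse semigroup laws:
`(α, g, β)` relates `(βm, k)` to `(α gm, φ(g, m) k)`. -/
def Rel : D.InvSemigroup → V × List Ed × G → V × List Ed × G → Prop
  | zero, _, _ => False
  | triple α g β _, a, b => ∃ m, a.1 = β.rng ∧ a.2.1 = β.edges ++ m ∧ b.1 = α.rng ∧
      b.2.1 = α.edges ++ D.actEdges g m ∧ b.2.2 = D.cocEdges g m * a.2.2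

theorem triple_congr {α α' β β' : D.FinPath} {g g' : G} {h : α.src = g • β.src}
    {h' : α'.src = g' • β'.src} (e1 : α = α') (e2 : g = g') (e3 : β = β') :
    triple α g β h = triple α' g' β' h' := by
  subst e1 e2 e3; rfl

theorem rel_injective {s t : D.InvSemigroup} (h : ∀ a b, Rel s a b ↔ Rel t a b) : s = t := by
  have key : ∀ α g β (hs : α.src = g • β.src), Rel (triple (D := D) α g β hs)
      (β.rng, β.edges, 1) (α.rng, α.edges, g) := fun α g β hs =>
    ⟨[], by simp [actEdges, cocEdges]⟩
  cases s with
  | zero => cases t with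
    | zero => rfl
    | triple α g β hs => exact ((h _ _).2 (key α g β hs)).elim
  | triple α g β hs => cases t with
    | zero => exact ((h _ _).1 (key α g β hs)).elim
    | triple α' g' β' ht =>
      obtain ⟨m, h1, h2, h3, h4, h5⟩ := (h _ _).1 (key α g β hs)
      obtain ⟨m', h1', h2', h3', h4', h5'⟩ := (h _ _).2 (key α' g' β' ht)
      dsimp only at *
      have hm : m = [] := by
        have e1 := congrArg List.length h2
        have e2 := congrArg List.length h2'
        simp only [List.length_append] at e1 e2
        exact List.eq_nil_of_length_eq_zero (by omega)
      subst hm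
      simp only [actEdges, cocEdges, List.append_nil, mul_one] at *
      exact triple_congr (DirectedGraph.Path.ext h3 h4) h5 (DirectedGraph.Path.ext h1 h2)

theorem rel_mul (s t : D.InvSemigroup) (a c : V × List Ed × G) :
    Rel (mul s t) a c ↔ ∃ b, Rel t a b ∧ Rel s b c := by
  cases s with
  | zero => simp [mul, Rel]
  | triple α g β hs => cases t with
    | zero => simp [mul, Rel]
    | triple γ h δ ht =>
      obtain ⟨x, l, k⟩ := a
      obtain ⟨y, l', k'⟩ := c
      by_cases h1 : β.IsPrefix γ
      · have hr := DirectedGraph.Path.rng_eq_of_isPrefix h1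
        have he := DirectedGraph.Path.edges_rest h1
        simp only [mul, dif_pos h1, Rel, DirectedGraph.Path.comp, act, coc]
        generalize DirectedGraph.Path.rest h1 = ε at *
        constructor
        · rintro ⟨m, e1, e2, e3, e4, e5⟩
          refine ⟨(γ.rng, γ.edges ++ D.actEdges h m, D.cocEdges h m * k),
            ⟨m, e1, e2, rfl, rfl, rfl⟩, ε.edges ++ D.actEdges h m, hr.symm, ?_, e3, ?_, ?_⟩
          · simp [← he]
          · rw [e4]
            simp [actEdges_append, actEdges_mul]
          · rw [e5]
            simp [cocEdges_append, cocEdges_mul, mul_assoc]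
        · rintro ⟨⟨z, n, j⟩, ⟨m, e1, e2, e3, e4, e5⟩, m', f1, f2, f3, f4, f5⟩
          dsimp only at *
          have hm' : m' = ε.edges ++ D.actEdges h m := by
            rw [e4, ← he, List.append_assoc] at f2
            exact (List.append_cancel_left f2).symm
          subst hm'
          refine ⟨m, e1, e2, f3, ?_, ?_⟩
          · rw [f4]
            simp [actEdges_append, actEdges_mul]
          · rw [f5, e5]
            simp [cocEdges_append, cocEdges_mul, mul_assoc]
      · by_cases h2 : γ.IsPrefix β
        · have hr := DirectedGraph.Path.rng_eq_of_isPrefix h2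
          have he := DirectedGraph.Path.edges_rest h2
          simp only [mul, dif_neg h1, dif_pos h2, Rel, DirectedGraph.Path.comp, act, coc]
          generalize DirectedGraph.Path.rest h2 = ε at *
          have hu : D.actEdges h (D.actEdges h⁻¹ ε.edges) = ε.edges := by
            rw [← actEdges_mul, mul_inv_cancel, actEdges_one]
          have hv : (D.cocEdges h⁻¹ ε.edges)⁻¹ = D.cocEdges h (D.actEdges h⁻¹ ε.edges) := by
            rw [cocEdges_inv, inv_inv]
          rw [hv]
          constructor
          · rintro ⟨m, e1, e2, e3, e4, e5⟩
            refine ⟨(γ.rng, γ.edges ++ D.actEdges h (D.actEdges h⁻¹ ε.edges ++ m),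
              D.cocEdges h (D.actEdges h⁻¹ ε.edges ++ m) * k),
              ⟨_, e1, ?_, rfl, rfl, rfl⟩,
              D.actEdges (D.cocEdges h (D.actEdges h⁻¹ ε.edges)) m, hr, ?_, e3, ?_, ?_⟩
            · rw [e2]; simp
            · simp [actEdges_append, hu, ← he]
            · rw [e4]; simp [actEdges_mul]
            · rw [e5]; simp [cocEdges_mul, cocEdges_append, mul_assoc]
          · rintro ⟨⟨z, n, j⟩, ⟨m, e1, e2, e3, e4, e5⟩, m', f1, f2, f3, f4, f5⟩
            dsimp only at *
            have hm : D.actEdges h m = ε.edges ++ m' := by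
              rw [e4, ← he, List.append_assoc] at f2
              exact List.append_cancel_left f2
            have hm2 : m = D.actEdges h⁻¹ ε.edges ++ D.actEdges (D.cocEdges h⁻¹ ε.edges) m' := by
              rw [← actEdges_append, ← hm, ← actEdges_mul, inv_mul_cancel, actEdges_one]
            have hm3 : m' = D.actEdges (D.cocEdges h (D.actEdges h⁻¹ ε.edges))
                (D.actEdges (D.cocEdges h⁻¹ ε.edges) m') := by
              rw [← actEdges_mul, ← hv, inv_mul_cancel, actEdges_one]
            refine ⟨D.actEdges (D.cocEdges h⁻¹ ε.edges) m', e1, ?_, f3, ?_, ?_⟩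
            · rw [e2, hm2]; simp
            · rw [f4, actEdges_mul, ← hm3]
            · rw [f5, e5, cocEdges_mul, ← hm3]
              conv_lhs => rw [hm2, cocEdges_append]
              simp [mul_assoc]
        · simp only [mul, dif_neg h1, dif_neg h2, Rel, false_iff]
          rintro ⟨⟨z, n, j⟩, ⟨m, e1, e2, e3, e4, e5⟩, m', f1, f2, f3, f4, f5⟩
          dsimp only at *
          rw [DirectedGraph.Path.isPrefix_iff] at h1 h2
          have hr : β.rng = γ.rng := f1.symm.trans e3
          rw [e4] at f2
          rcases List.prefix_or_prefix_of_prefix (l₃ := γ.edges ++ D.actEdges h m)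
            ⟨_, rfl⟩ ⟨_, f2.symm⟩ with hp | hp
          · exact h2 ⟨hr.symm, hp⟩
          · exact h1 ⟨hr, hp⟩

theorem mul_assoc' (s t u : D.InvSemigroup) : mul (mul s t) u = mul s (mul t u) := by
  apply rel_injective
  intro a b
  simp only [rel_mul]
  constructor
  · rintro ⟨c, h1, d, h2, h3⟩; exact ⟨d, ⟨c, h1, h2⟩, h3⟩
  · rintro ⟨d, ⟨c, h1, h2⟩, h3⟩; exact ⟨c, h1, d, h2, h3⟩

theorem rel_adj (s : D.InvSemigroup) (a b : V × List Ed × G) :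
    Rel (adj s) a b ↔ Rel s b a := by
  cases s with
  | zero => rfl
  | triple α g β hs =>
    obtain ⟨x, l, k⟩ := a
    obtain ⟨y, l', k'⟩ := b
    constructor
    · rintro ⟨m, e1, e2, e3, e4, e5⟩
      refine ⟨D.actEdges g⁻¹ m, e3, e4, e1, ?_, ?_⟩
      · rw [e2, ← actEdges_mul, mul_inv_cancel, actEdges_one]
      · rw [show k' = _ from e5, cocEdges_inv]; simp
    · rintro ⟨m, e1, e2, e3, e4, e5⟩
      refine ⟨D.actEdges g m, e3, e4, e1, ?_, ?_⟩
      · rw [e2, ← actEdges_mul, inv_mul_cancel, actEdges_one]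
      · rw [show k = _ from e5, cocEdges_inv, ← actEdges_mul, inv_mul_cancel, actEdges_one]; simp

theorem rel_unique {s : D.InvSemigroup} {a b c : V × List Ed × G} (h1 : Rel s a b)
    (h2 : Rel s a c) : b = c := by
  cases s with
  | zero => exact h1.elim
  | triple α g β hs =>
    obtain ⟨m, e1, e2, e3, e4, e5⟩ := h1
    obtain ⟨m', f1, f2, f3, f4, f5⟩ := h2
    have : m = m' := List.append_cancel_left (e2.symm.trans f2)
    subst this
    exact Prod.ext (e3.trans f3.symm) (Prod.ext (e4.trans f4.symm) (e5.trans f5.symm))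

theorem mul_adj_mul (s : D.InvSemigroup) : mul (mul s (adj s)) s = s := by
  apply rel_injective
  intro a b
  simp only [rel_mul, rel_adj]
  constructor
  · rintro ⟨c, h1, d, h2, h3⟩
    have : a = d := rel_unique (s := adj s) ((rel_adj _ _ _).2 h1) ((rel_adj _ _ _).2 h2)
    rw [this]; exact h3
  · intro h; exact ⟨b, h, a, h, h⟩

theorem adj_adj (s : D.InvSemigroup) : adj (adj s) = s :=
  rel_injective fun a b => by rw [rel_adj, rel_adj]

theorem rel_of_idem {s : D.InvSemigroup} (hs : mul s s = s) {a b : V × List Ed × G}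
    (h : Rel s a b) : a = b := by
  have h2 := h
  rw [← hs, rel_mul] at h2
  obtain ⟨c, h3, h4⟩ := h2
  have : b = c := rel_unique h h3
  subst this
  exact rel_unique (s := adj s) ((rel_adj _ _ _).2 h) ((rel_adj _ _ _).2 h4)

theorem idem_comm' {s t : D.InvSemigroup} (hs : mul s s = s) (ht : mul t t = t) :
    mul s t = mul t s := by
  apply rel_injective
  intro a b
  simp only [rel_mul]
  constructor
  · rintro ⟨c, h1, h2⟩
    have e1 := rel_of_idem ht h1
    have e2 := rel_of_idem hs h2
    subst e1 e2
    exact ⟨a, h2, h1⟩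
  · rintro ⟨c, h1, h2⟩
    have e1 := rel_of_idem hs h1
    have e2 := rel_of_idem ht h2
    subst e1 e2
    exact ⟨a, h2, h1⟩

end InvSemigroup

end SelfSimilarGraph

/-! ## Inverse semigroups with zero, tight filters and the tight groupoid -/

/-- An inverse semigroup with zero: every element `s` has a generalized inverse `s*`, and
idempotents commute (so that `s*` is unique). -/
class InverseSemigroupWithZero (S : Type*) extends SemigroupWithZero S, Star S where
  mul_star_mul : ∀ s : S, s * star s * s = s
  star_mul_star : ∀ s : S, star s * s * star s = star s
  idem_comm : ∀ e f : S, IsIdempotentElem e → IsIdempotentElem f → e * f = f * e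

noncomputable instance SelfSimilarGraph.InvSemigroup.instInverseSemigroupWithZero {G V Ed : Type*}
    [Group G] [MulAction G V] [MulAction G Ed] (D : SelfSimilarGraph G V Ed) :
    InverseSemigroupWithZero D.InvSemigroup where
  mul := mul
  mul_assoc := mul_assoc'
  zero := zero
  zero_mul _ := rfl
  mul_zero s := by cases s <;> rfl
  star := adj
  mul_star_mul := mul_adj_mul
  star_mul_star s := (congrArg (fun t => mul (mul (adj s) t) (adj s)) (adj_adj s).symm).trans
    (mul_adj_mul (adj s))
  idem_comm _ _ h1 h2 := idem_comm' h1 h2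

namespace InverseSemigroupWithZero

variable {S : Type*} [InverseSemigroupWithZero S]

/-- A filter in the semilattice of idempotents of `S`: a nonempty set of nonzero idempotents,
closed under products (meets) and upward closed for `e ≤ f ↔ ef = e`. -/
structure IsFilter (F : Set S) : Prop where
  idem : ∀ e ∈ F, IsIdempotentElem e
  nonempty : F.Nonempty
  zero_notMem : 0 ∉ F
  mul_mem : ∀ e ∈ F, ∀ f ∈ F, e * f ∈ F
  mem_of_le : ∀ e ∈ F, ∀ f : S, IsIdempotentElem f → e * f = e → f ∈ F

/-- The set of the idempotents `z` such that `z ≤ x` for all `x ∈ X` and `z y = 0` for all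
`y ∈ Y`. -/
def between (X Y : Set S) : Set S :=
  {z | IsIdempotentElem z ∧ (∀ x ∈ X, z * x = z) ∧ ∀ y ∈ Y, z * y = 0}

/-- `Z` is a cover for the set `F` of idempotents: `Z ⊆ F`, and every nonzero `x ∈ F`
satisfies `z x ≠ 0` for some `z ∈ Z`. -/
def IsCover (Z F : Set S) : Prop :=
  Z ⊆ F ∧ ∀ x ∈ F, x ≠ 0 → ∃ z ∈ Z, z * x ≠ 0

/-- A filter `F` of idempotents is tight: whenever `X` and `Y` are finite sets of idempotents with
`X ⊆ F` and `Y ∩ F = ∅`, every finite cover of `between X Y` meets `F`. Equivalently, the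
characteristic function `χ` of `F` satisfies
`⋁_{z ∈ Z} χ(z) ≥ ⋀_{x ∈ X} χ(x) ∧ ⋀_{y ∈ Y} ¬ χ(y)` for all finite sets `X`, `Y` of idempotents
and all finite covers `Z` of `between X Y`. -/
def IsTight (F : Set S) : Prop :=
  ∀ X Y Z : Set S, X.Finite → Y.Finite → Z.Finite → X ⊆ F →
    (∀ y ∈ Y, IsIdempotentElem y ∧ y ∉ F) → IsCover Z (between X Y) → ∃ z ∈ Z, z ∈ F

variable (S) in
/-- The space of tight filters over the semilattice of idempotents of `S`. -/
structure TightFilter where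
  carrier : Set S
  isFilter : IsFilter carrier
  isTight : IsTight carrier

instance : Membership S (TightFilter S) := ⟨fun F e => e ∈ F.carrier⟩

open Classical in
/-- The topology of pointwise convergence of characteristic functions, i.e. the one
induced from the product topology on `{0, 1}^S` (with `{0, 1}` discrete). -/
noncomputable instance : TopologicalSpace (TightFilter S) :=
  TopologicalSpace.induced (fun F (e : S) => decide (e ∈ F)) inferInstance

/-- The domain of the partial homeomorphism of the space of tight filters given by `s`:
the tight filters containing `s* s`. -/
def dom (s : S) : Set (TightFilter S) := {F | star s * s ∈ F}

variable (S) in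
/-- Pairs `(s, F)` with `F` in the domain of `s`. -/
def GermPair : Type _ := {p : S × TightFilter S // p.2 ∈ dom p.1}

/-- `(s, F)` and `(t, F')` have the same germ: `F = F'` and there is an
idempotent `e` with `F` in the domain of `e` (that is, `e ∈ F`) and `s e = t e`. -/
def germSetoid : Setoid (GermPair S) where
  r p q := p.1.2 = q.1.2 ∧ ∃ e : S, IsIdempotentElem e ∧ e ∈ p.1.2 ∧ p.1.1 * e = q.1.1 * e
  iseqv :=
    { refl := fun p => ⟨rfl, star p.1.1 * p.1.1, p.1.2.isFilter.idem _ p.2, p.2, rfl⟩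
      symm := fun ⟨h, e, he, hm, hse⟩ => ⟨h.symm, e, he, h ▸ hm, hse.symm⟩
      trans := fun {p q u} ⟨h, e, he, hm, hse⟩ ⟨h', f, hf, hm', hsf⟩ => by
        have hef := p.1.2.isFilter.mul_mem e hm f (show f ∈ p.1.2 from h ▸ hm')
        refine ⟨h.trans h', e * f, p.1.2.isFilter.idem _ hef, hef, ?_⟩
        calc p.1.1 * (e * f) = q.1.1 * (e * f) := by rw [← mul_assoc, hse, mul_assoc]
          _ = q.1.1 * (f * e) := by rw [idem_comm e f he hf]
          _ = u.1.1 * (f * e) := by rw [← mul_assoc, hsf, mul_assoc]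
          _ = u.1.1 * (e * f) := by rw [idem_comm e f he hf] }

variable (S) in
/-- The tight groupoid of `S`: the germs `[s, F]` of the canonical action of `S` on its space of
tight filters, in which `s` maps `F ∈ dom s` to `{e : s* e s ∈ F}`. It is considered here as a
topological space (topologized below): its product and inverse,
`[s, tF] [t, F] = [s t, F]` and `[s, F]⁻¹ = [s*, sF]`, do not enter into its being Hausdorff. -/
def TightGroupoid : Type _ := Quotient (germSetoid (S := S))

/-- The germ `[s, F]`. -/
def germ (s : S) (F : TightFilter S) (h : F ∈ dom s) : TightGroupoid S :=
  Quotient.mk germSetoid ⟨(s, F), h⟩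

/-- `Θ(s, U) = {[s, F] : F ∈ U}`, for `U` contained in the domain of `s`. -/
def Theta (s : S) (U : Set (TightFilter S)) (hU : U ⊆ dom s) : Set (TightGroupoid S) :=
  {u | ∃ (F : TightFilter S) (h : F ∈ U), u = germ s F (hU h)}

/-- The topology on the tight groupoid, generated by the sets `Θ(s, U)` where
`s ∈ S` and `U` is an open subset of the domain of `s`. -/
instance : TopologicalSpace (TightGroupoid S) :=
  TopologicalSpace.generateFrom
    {W | ∃ (s : S) (U : Set (TightFilter S)) (hU : U ⊆ dom s), IsOpen U ∧ W = Theta s U hU}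

end InverseSemigroupWithZero

/-! Every nonzero idempotent is `(α, 1, α)` for a finite path `α`, and a longer path gives a smaller
idempotent. So a filter is the set of prefixes of a finite or infinite path, and a basic clopen set
of filters is the cylinder of a path.

Two germs at one filter have representatives `(α, g, β)` and `(α', g', β)` with the same last entry.
By `triple_mul_idem_eq_iff` and `mem_agree_iff` they coincide exactly when `α = α'` and the filter
contains `βμ` for some minimal strongly fixed path `μ` of `g'⁻¹g`. The locus of agreement is
therefore a union of cylinders indexed by such `μ`. If there are finitely many, this union is clopen
in the cylinder of `β`, and distinct germs at one filter separate; germs at different filters always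
separate, since their base points do.

Conversely, suppose that `g` has infinitely many minimal strongly fixed paths. As the graph is
finite, König's lemma gives an infinite path each of whose prefixes extends to infinitely many of
them. Let `F` be its filter, which is tight because it contains arbitrarily long paths
(`isTight_of_unbounded`). Tight filters through minimal strongly fixed paths `μₙ` that follow the
infinite path ever longer converge to `F`, and at each of them `g` and `1` have the same germ. In a
Hausdorff groupoid they then have the same germ at `F`, so some minimal strongly fixed `γ` is a
prefix of the infinite path. But `γ` also has infinitely many minimal strongly fixed extensions,
against their minimality. -/

open InverseSemigroupWithZero Filter Topology

/-! ### Prefix order on finite paths -/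

namespace DirectedGraph.Path

variable {V Ed : Type*} {E : DirectedGraph V Ed}

theorem IsPrefix.refl (α : E.Path) : α.IsPrefix α :=
  (isPrefix_iff _ _).2 ⟨rfl, List.prefix_rfl⟩

theorem IsPrefix.trans {α β γ : E.Path} (h : α.IsPrefix β) (h' : β.IsPrefix γ) :
    α.IsPrefix γ := by
  rw [isPrefix_iff] at *
  exact ⟨h.1.trans h'.1, h.2.trans h'.2⟩

theorem IsPrefix.length_le {α β : E.Path} (h : α.IsPrefix β) :
    α.edges.length ≤ β.edges.length :=
  ((isPrefix_iff _ _).1 h).2.length_le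

theorem IsPrefix.eq_of_length_le {α β : E.Path} (h : α.IsPrefix β)
    (hl : β.edges.length ≤ α.edges.length) : α = β := by
  rw [isPrefix_iff] at h
  exact Path.ext h.1 (h.2.eq_of_length_le hl)

theorem isPrefix_of_length_le {α β γ : E.Path} (hα : α.IsPrefix γ) (hβ : β.IsPrefix γ)
    (hl : α.edges.length ≤ β.edges.length) : α.IsPrefix β := by
  rw [isPrefix_iff] at *
  exact ⟨hα.1.trans hβ.1.symm, List.prefix_of_prefix_length_le hα.2 hβ.2 hl⟩

/-- The path `αe`, for an edge `e` with `r(e) = d(α)`. -/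
def snoc (α : E.Path) (e : Ed) (h : α.src = E.r e) : E.Path :=
  α.comp ⟨E.r e, [e], rfl, trivial⟩ h

theorem isPrefix_snoc (α : E.Path) (e : Ed) (h : α.src = E.r e) : α.IsPrefix (α.snoc e h) :=
  ⟨_, h, rfl⟩

theorem length_snoc (α : E.Path) (e : Ed) (h : α.src = E.r e) :
    (α.snoc e h).edges.length = α.edges.length + 1 := by
  simp [snoc, comp]

theorem IsPrefix.exists_snoc {α β : E.Path} (h : α.IsPrefix β) (hne : β ≠ α) :
    ∃ (e : Ed) (he : α.src = E.r e), (α.snoc e he).IsPrefix β := by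
  obtain ⟨⟨x, l, hl⟩, hx, rfl⟩ := h
  cases l with
  | nil => exact (hne (Path.ext rfl (List.append_nil _))).elim
  | cons e l =>
    refine ⟨e, hx.trans hl.1.symm, (isPrefix_iff _ _).2 ⟨rfl, l, ?_⟩⟩
    simp [snoc, comp]

end DirectedGraph.Path

/-! ### Strongly fixed paths -/

namespace SelfSimilarGraph

variable {G V Ed : Type*} [Group G] [MulAction G V] [MulAction G Ed]
  {D : SelfSimilarGraph G V Ed}

/-- Proper prefixes are strictly shorter, so descent through strongly fixed prefixes stops. -/
theorem StronglyFixed.exists_minimal {g : G} {α : D.FinPath} (h : D.StronglyFixed g α) :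
    ∃ β : D.FinPath, β.IsPrefix α ∧ D.MinimalStronglyFixed g β := by
  induction hn : α.edges.length using Nat.strong_induction_on generalizing α with
  | _ n ih =>
    by_cases hm : D.MinimalStronglyFixed g α
    · exact ⟨α, .refl α, hm⟩
    · have : ∃ β : D.FinPath, β.IsPrefix α ∧ β ≠ α ∧ D.StronglyFixed g β := by
        by_contra! hc
        exact hm ⟨h, hc⟩
      obtain ⟨β, hβ, hne, hf⟩ := this
      obtain ⟨γ, hγ, hmin⟩ := ih _ (hn ▸ lt_of_not_ge fun hl => hne (hβ.eq_of_length_le hl)) hf rfl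
      exact ⟨γ, hγ.trans hβ, hmin⟩

/-- Once `gα = hα`, the cocycle identity gives `φ(h⁻¹g, α) = φ(h, α)⁻¹ φ(g, α)`. -/
theorem stronglyFixed_inv_mul_iff {g h : G} {α : D.FinPath} :
    D.StronglyFixed (h⁻¹ * g) α ↔ g • α.rng = h • α.rng ∧
      D.actEdges g α.edges = D.actEdges h α.edges ∧
      D.cocEdges g α.edges = D.cocEdges h α.edges := by
  have key : D.actEdges (h⁻¹ * g) α.edges = α.edges ↔
      D.actEdges g α.edges = D.actEdges h α.edges := by
    constructor
    · intro e
      conv_rhs => rw [← e, ← actEdges_mul, mul_inv_cancel_left]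
    · intro e
      rw [actEdges_mul, e, ← actEdges_mul, inv_mul_cancel, actEdges_one]
  have key2 : D.actEdges g α.edges = D.actEdges h α.edges →
      (D.cocEdges (h⁻¹ * g) α.edges = 1 ↔ D.cocEdges g α.edges = D.cocEdges h α.edges) := by
    intro e
    rw [cocEdges_mul, e, cocEdges_inv, ← actEdges_mul, inv_mul_cancel, actEdges_one,
      inv_mul_eq_one, eq_comm]
  rw [StronglyFixed, DirectedGraph.Path.ext_iff]
  simp only [act, coc, key, mul_smul, inv_smul_eq_iff]
  tauto

theorem smul_eq_of_cocEdges_eq {g h : G} {l : List Ed} (e : D.cocEdges g l = D.cocEdges h l)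
    (x : V) : g • x = h • x := by
  rw [← D.cocEdges_smul l g, e, D.cocEdges_smul]

/-! ### Idempotents and restriction of triples -/

namespace InvSemigroup

theorem rel_mul_iff (s t : D.InvSemigroup) (a c : V × List Ed × G) :
    Rel (s * t) a c ↔ ∃ b, Rel t a b ∧ Rel s b c := rel_mul s t a c

/-- The idempotent `(α, 1, α)`. -/
def idem (α : D.FinPath) : D.InvSemigroup := triple α 1 α (one_smul _ _).symm

/-- In the representation by relations, idempotents are partial identities, so their products become
intersections of domains. -/
theorem rel_idem (α : D.FinPath) (a b : V × List Ed × G) :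
    Rel (idem α) a b ↔ a = b ∧ a.1 = α.rng ∧ α.edges <+: a.2.1 := by
  obtain ⟨x, l, k⟩ := a
  obtain ⟨y, l', k'⟩ := b
  constructor
  · rintro ⟨m, h1, h2, h3, h4, h5⟩
    dsimp only at *
    subst h1 h2 h3 h4 h5
    simp [actEdges_one, cocEdges_one]
  · rintro ⟨⟨⟩, rfl, m, h⟩
    exact ⟨m, rfl, h.symm, rfl, by simp [actEdges_one, h], by simp [cocEdges_one]⟩

theorem not_rel_zero (a b : V × List Ed × G) : ¬ Rel (0 : D.InvSemigroup) a b := fun h => h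

theorem idem_ne_zero (α : D.FinPath) : idem α ≠ 0 := by
  intro h
  exact not_rel_zero (D := D) (α.rng, α.edges, 1) _
    (h ▸ (rel_idem α _ _).2 ⟨rfl, rfl, List.prefix_rfl⟩)

theorem isIdempotentElem_idem (α : D.FinPath) : IsIdempotentElem (idem α) :=
  rel_injective fun a b => by
    simp only [rel_mul_iff, rel_idem]
    grind

theorem eq_idem_of_isIdempotentElem {s : D.InvSemigroup} (hs : IsIdempotentElem s)
    (h0 : s ≠ 0) : ∃ α, s = idem α := by
  cases s with
  | zero => exact (h0 rfl).elim
  | triple α g β h =>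
    have := rel_of_idem hs (a := (β.rng, β.edges, 1)) (b := (α.rng, α.edges, g))
      ⟨[], by simp [actEdges, cocEdges]⟩
    simp only [Prod.mk.injEq] at this
    exact ⟨β, triple_congr (DirectedGraph.Path.ext this.1.symm this.2.1.symm) this.2.2.symm rfl⟩

theorem idem_mul_of_isPrefix {α β : D.FinPath} (h : α.IsPrefix β) :
    idem β * idem α = idem β := by
  rw [DirectedGraph.Path.isPrefix_iff] at h
  refine rel_injective fun a b => ?_
  simp only [rel_mul_iff, rel_idem]
  constructor
  · rintro ⟨c, ⟨rfl, -⟩, h'⟩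
    exact h'
  · rintro ⟨rfl, h1, h2⟩
    exact ⟨a, ⟨rfl, h1.trans h.1.symm, h.2.trans h2⟩, rfl, h1, h2⟩

theorem isPrefix_of_idem_mul {α β : D.FinPath} (h : idem β * idem α = idem β) :
    α.IsPrefix β := by
  have := (rel_idem β (β.rng, β.edges, 1) _).2 ⟨rfl, rfl, List.prefix_rfl⟩
  rw [← h, rel_mul_iff] at this
  obtain ⟨c, h1, -⟩ := this
  rw [rel_idem] at h1
  exact (DirectedGraph.Path.isPrefix_iff _ _).2 ⟨h1.2.1.symm, h1.2.2⟩

/-- A point in both domains carries a path that has `α` and `β` as prefixes, and two prefixes of one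
path are comparable. -/
theorem isPrefix_or_isPrefix {α β : D.FinPath} (h : idem α * idem β ≠ 0) :
    α.IsPrefix β ∨ β.IsPrefix α := by
  by_contra hc
  refine h (rel_injective fun a b => ⟨fun hr => ?_, fun hr => (not_rel_zero _ _ hr).elim⟩)
  rw [rel_mul_iff] at hr
  obtain ⟨c, h1, h2⟩ := hr
  rw [rel_idem] at h1 h2
  obtain ⟨rfl, e1, e2⟩ := h1
  obtain ⟨rfl, f1, f2⟩ := h2
  refine hc ?_
  simp only [DirectedGraph.Path.isPrefix_iff]
  rcases List.prefix_or_prefix_of_prefix e2 f2 with hp | hp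
  · exact .inr ⟨e1.symm.trans f1, hp⟩
  · exact .inl ⟨f1.symm.trans e1, hp⟩

theorem idem_mul_comm (α β : D.FinPath) : idem α * idem β = idem β * idem α :=
  idem_comm _ _ (isIdempotentElem_idem α) (isIdempotentElem_idem β)

theorem star_mul_triple (α : D.FinPath) (g : G) (β : D.FinPath) (h : α.src = g • β.src) :
    star (triple α g β h) * triple α g β h = idem β := by
  refine rel_injective fun a b => ?_
  rw [rel_mul_iff, rel_idem]
  have hr : ∀ c, Rel (star (triple α g β h)) c b ↔ Rel (triple α g β h) b c :=
    fun c => rel_adj _ _ _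
  simp only [hr]
  constructor
  · rintro ⟨c, h1, h2⟩
    refine ⟨rel_unique (s := adj (triple α g β h)) ((rel_adj _ _ _).2 h1) ((rel_adj _ _ _).2 h2),
      ?_⟩
    obtain ⟨m, e1, e2, -⟩ := h1
    exact ⟨e1, m, e2.symm⟩
  · rintro ⟨rfl, e1, m, e2⟩
    have : Rel (triple α g β h) a (α.rng, α.edges ++ D.actEdges g m, D.cocEdges g m * a.2.2) :=
      ⟨m, e1, e2.symm, rfl, rfl, rfl⟩
    exact ⟨_, this, this⟩

theorem triple_mul_idem (α : D.FinPath) (g : G) {β γ : D.FinPath} (h : α.src = g • β.src)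
    (hβ : β.IsPrefix γ) :
    ∃ (α' : D.FinPath) (g' : G) (h' : α'.src = g' • γ.src),
      triple α g β h * idem γ = triple α' g' γ h' := by
  change ∃ α' g' h', mul (triple α g β h) (triple γ 1 γ _) = triple α' g' γ h'
  simp only [mul, dif_pos hβ]
  exact ⟨_, _, by
    rw [DirectedGraph.Path.src_comp, src_act, DirectedGraph.Path.src_rest, mul_one, coc_smul], rfl⟩

/-- Two triples agree below `(βμ, 1, βμ)` if and only if their first entries coincide and the
quotient of their group elements strongly fixes `μ`. -/
theorem triple_mul_idem_eq_iff {α α' β : D.FinPath} {g g' : G} (h : α.src = g • β.src)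
    (h' : α'.src = g' • β.src) (μ : D.FinPath) (hμ : β.src = μ.rng) :
    triple α g β h * idem (β.comp μ hμ) = triple α' g' β h' * idem (β.comp μ hμ) ↔
      α = α' ∧ D.StronglyFixed (g'⁻¹ * g) μ := by
  rw [stronglyFixed_inv_mul_iff]
  constructor
  · intro e
    -- Test point: its image under the first product records `α gμ` and `φ(g, μ)`, to be compared
    -- with the image under the second.
    have hr : Rel (triple α g β h * idem (β.comp μ hμ)) (β.rng, β.edges ++ μ.edges, 1)
        (α.rng, α.edges ++ D.actEdges g μ.edges, D.cocEdges g μ.edges) :=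
      (rel_mul_iff _ _ _ _).2 ⟨_, (rel_idem _ _ _).2 ⟨rfl, rfl, List.prefix_rfl⟩,
        μ.edges, rfl, rfl, rfl, rfl, (mul_one _).symm⟩
    rw [e, rel_mul_iff] at hr
    obtain ⟨c, h1, m, -, h2, h3, h4, h5⟩ := hr
    obtain ⟨rfl, -⟩ := (rel_idem _ _ _).1 h1
    dsimp only at *
    obtain rfl := List.append_cancel_left h2
    -- The action preserves length, so `gμ` and `g'μ` are tails of equal length and the
    -- concatenations split at the same place.
    obtain ⟨h6, h7⟩ := List.append_inj' h4 (by simp [length_actEdges])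
    rw [mul_one] at h5
    exact ⟨DirectedGraph.Path.ext h3 h6, smul_eq_of_cocEdges_eq h5 _, h7, h5⟩
  · rintro ⟨rfl, -, h2, h3⟩
    refine rel_injective fun a b => ?_
    simp only [rel_mul_iff, rel_idem]
    refine exists_congr fun c => and_congr_right ?_
    rintro ⟨rfl, -, m, hm⟩
    replace hm : a.2.1 = β.edges ++ (μ.edges ++ m) := by
      rw [← hm]; simp [DirectedGraph.Path.comp]
    refine exists_congr fun n => and_congr_right fun _ => and_congr_right fun hn => ?_
    obtain rfl : μ.edges ++ m = n := List.append_cancel_left (hm.symm.trans hn)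
    rw [actEdges_append, actEdges_append, cocEdges_append, cocEdges_append, h2, h3]

end InvSemigroup

end SelfSimilarGraph

/-! ### The topologies on tight filters and on germs -/

namespace InverseSemigroupWithZero

variable {S : Type*} [InverseSemigroupWithZero S]

theorem TightFilter.ext {F F' : TightFilter S} (h : ∀ e, e ∈ F ↔ e ∈ F') : F = F' := by
  cases F
  cases F'
  congr
  exact Set.ext h

theorem TightFilter.isOpen_setOf_mem (e : S) : IsOpen {F : TightFilter S | e ∈ F} := by
  classical
  refine isOpen_induced_iff.2 ⟨(fun f => f e) ⁻¹' {true}, ?_, ?_⟩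
  · exact (isOpen_discrete _).preimage (continuous_apply e)
  · ext F; simp

theorem TightFilter.isOpen_setOf_notMem (e : S) : IsOpen {F : TightFilter S | e ∉ F} := by
  classical
  refine isOpen_induced_iff.2 ⟨(fun f => f e) ⁻¹' {false}, ?_, ?_⟩
  · exact (isOpen_discrete _).preimage (continuous_apply e)
  · ext F; simp

theorem TightFilter.tendsto_iff {ι : Type*} {l : Filter ι} {u : ι → TightFilter S}
    {F : TightFilter S} :
    Tendsto u l (𝓝 F) ↔ ∀ e, ∀ᶠ i in l, (e ∈ u i ↔ e ∈ F) := by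
  classical
  rw [nhds_induced, tendsto_comap_iff, tendsto_pi_nhds]
  refine forall_congr' fun e => ?_
  rw [nhds_discrete, tendsto_pure]
  simp

instance : T2Space (TightFilter S) := by
  refine ⟨fun F F' hne => ?_⟩
  have : ∃ e, ¬ (e ∈ F ↔ e ∈ F') := by
    by_contra! hc
    exact hne (TightFilter.ext hc)
  obtain ⟨e, he⟩ := this
  have hd : Disjoint {F : TightFilter S | e ∈ F} {F | e ∉ F} :=
    Set.disjoint_left.2 fun _ h h' => h' h
  by_cases h : e ∈ F
  · exact ⟨_, _, TightFilter.isOpen_setOf_mem e, TightFilter.isOpen_setOf_notMem e, h,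
      fun h' => he ⟨fun _ => h', fun _ => h⟩, hd⟩
  · exact ⟨_, _, TightFilter.isOpen_setOf_notMem e, TightFilter.isOpen_setOf_mem e, h,
      by_contra fun h' => he ⟨fun h'' => (h h'').elim, fun h'' => (h' h'').elim⟩, hd.symm⟩

theorem isOpen_dom (s : S) : IsOpen (dom s) := TightFilter.isOpen_setOf_mem _

theorem germ_eq_germ_iff {s t : S} {F F' : TightFilter S} (h : F ∈ dom s) (h' : F' ∈ dom t) :
    germ s F h = germ t F' h' ↔
      F = F' ∧ ∃ e : S, IsIdempotentElem e ∧ e ∈ F ∧ s * e = t * e :=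
  ⟨fun e => Quotient.exact e, fun e => Quotient.sound e⟩

theorem exists_germ (u : TightGroupoid S) :
    ∃ (s : S) (F : TightFilter S) (h : F ∈ dom s), u = germ s F h := by
  obtain ⟨⟨⟨s, F⟩, h⟩, rfl⟩ := Quotient.exists_rep u
  exact ⟨s, F, h, rfl⟩

theorem isOpen_Theta (s : S) {U : Set (TightFilter S)} (hU : U ⊆ dom s) (ho : IsOpen U) :
    IsOpen (Theta s U hU) :=
  TopologicalSpace.isOpen_generateFrom_of_mem ⟨s, U, hU, ho, rfl⟩

/-- The set of tight filters at which `s` and `t` have the same germ. -/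
def agree (s t : S) : Set (TightFilter S) :=
  {F | ∃ e : S, IsIdempotentElem e ∧ e ∈ F ∧ s * e = t * e}

/-- Agreement is always an open condition; separating germs at `F` requires that its failure at `F`
persist nearby. -/
theorem isOpen_agree (s t : S) : IsOpen (agree s t) := by
  have : agree s t =
      ⋃ e ∈ {e : S | IsIdempotentElem e ∧ s * e = t * e}, {F : TightFilter S | e ∈ F} := by
    ext F
    simp only [agree, Set.mem_ofPred_eq, Set.mem_iUnion, exists_prop]
    grind
  rw [this]
  exact isOpen_biUnion fun e _ => TightFilter.isOpen_setOf_mem e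

/-- `Θ(t, U)` pulls back to the part of `U` where `s` and `t` agree, which is open. -/
theorem continuous_germ (s : S) :
    Continuous fun F : dom s => germ s (F : TightFilter S) F.2 := by
  refine continuous_generateFrom_iff.2 ?_
  rintro _ ⟨t, U, hU, ho, rfl⟩
  have : (fun F : dom s => germ s (F : TightFilter S) F.2) ⁻¹' Theta t U hU =
      Subtype.val ⁻¹' (U ∩ agree s t) := by
    ext F
    simp only [Set.mem_preimage, Theta, Set.mem_ofPred_eq, germ_eq_germ_iff]
    constructor
    · rintro ⟨F', h, e, h'⟩
      exact ⟨e ▸ h, h'⟩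
    · rintro ⟨h, h'⟩
      exact ⟨F, h, rfl, h'⟩
  rw [this]
  exact (ho.inter (isOpen_agree s t)).preimage continuous_subtype_val

/-- The source map `[s, F] ↦ F`. -/
def TightGroupoid.base : TightGroupoid S → TightFilter S :=
  Quotient.lift (fun p => p.1.2) fun _ _ h => h.1

theorem TightGroupoid.base_germ (s : S) (F : TightFilter S) (h : F ∈ dom s) :
    TightGroupoid.base (germ s F h) = F := rfl

theorem TightGroupoid.continuous_base : Continuous (TightGroupoid.base (S := S)) := by
  refine ⟨fun U hU => ?_⟩
  have : TightGroupoid.base ⁻¹' U =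
      ⋃ s : S, Theta s (U ∩ dom s) Set.inter_subset_right := by
    ext u
    obtain ⟨s, F, h, rfl⟩ := exists_germ u
    simp only [Set.mem_preimage, base_germ, Set.mem_iUnion]
    constructor
    · exact fun hF => ⟨s, F, ⟨hF, h⟩, rfl⟩
    · rintro ⟨t, F', h', e⟩
      rw [((germ_eq_germ_iff _ _).1 e).1]
      exact h'.1
  rw [this]
  exact isOpen_iUnion fun s => isOpen_Theta s _ (hU.inter (isOpen_dom s))

/-- Two germs at `F` can be separated when `F` has a neighbourhood on which the germs of their
representatives differ everywhere. -/
theorem separate_germ {s t : S} {F : TightFilter S} (hs : F ∈ dom s) (ht : F ∈ dom t)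
    (hF : ∃ W, IsOpen W ∧ F ∈ W ∧ Disjoint W (agree s t)) :
    ∃ A B : Set (TightGroupoid S), IsOpen A ∧ IsOpen B ∧ germ s F hs ∈ A ∧ germ t F ht ∈ B ∧
      Disjoint A B := by
  obtain ⟨W, ho, hW, hd⟩ := hF
  refine ⟨Theta s (W ∩ dom s) Set.inter_subset_right, Theta t (W ∩ dom t) Set.inter_subset_right,
    isOpen_Theta s _ (ho.inter (isOpen_dom s)), isOpen_Theta t _ (ho.inter (isOpen_dom t)),
    ⟨F, ⟨hW, hs⟩, rfl⟩, ⟨F, ⟨hW, ht⟩, rfl⟩, Set.disjoint_left.2 ?_⟩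
  rintro _ ⟨F1, h1, rfl⟩ ⟨F2, h2, e⟩
  exact Set.disjoint_left.1 hd h1.1 ((germ_eq_germ_iff _ _).1 e).2

end InverseSemigroupWithZero

/-! ### Filters of idempotents and long paths -/

namespace SelfSimilarGraph

open InvSemigroup

variable {G V Ed : Type*} [Group G] [MulAction G V] [MulAction G Ed]
  {D : SelfSimilarGraph G V Ed}

namespace InvSemigroup

section Filters

variable {F : Set D.InvSemigroup}

theorem exists_idem_of_mem (hF : IsFilter F) {e : D.InvSemigroup} (he : e ∈ F) :
    ∃ α, e = idem α :=
  eq_idem_of_isIdempotentElem (hF.idem e he) fun h => hF.zero_notMem (h ▸ he)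

theorem idem_mem_of_isPrefix (hF : IsFilter F) {α β : D.FinPath} (h : α.IsPrefix β)
    (hβ : idem β ∈ F) : idem α ∈ F :=
  hF.mem_of_le _ hβ _ (isIdempotentElem_idem α) (idem_mul_of_isPrefix h)

theorem isPrefix_or_isPrefix_of_mem (hF : IsFilter F) {α β : D.FinPath} (hα : idem α ∈ F)
    (hβ : idem β ∈ F) : α.IsPrefix β ∨ β.IsPrefix α :=
  isPrefix_or_isPrefix fun h => hF.zero_notMem (h ▸ hF.mul_mem _ hα _ hβ)

theorem isPrefix_of_mem (hF : IsFilter F) {α β : D.FinPath} (hα : idem α ∈ F)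
    (hβ : idem β ∈ F) (hl : α.edges.length ≤ β.edges.length) : α.IsPrefix β := by
  rcases isPrefix_or_isPrefix_of_mem hF hα hβ with h | h
  · exact h
  · rw [h.eq_of_length_le hl]
    exact .refl α

/-- The length of the path `β` in `(α, g, β)`, and `0` for the zero element. -/
noncomputable def sourceLength : D.InvSemigroup → ℕ
  | zero => 0
  | triple _ _ β _ => β.edges.length

theorem sourceLength_idem (α : D.FinPath) : sourceLength (idem α) = α.edges.length := rfl

/-- A filter that contains arbitrarily long paths is tight. -/
theorem isTight_of_unbounded (hF : IsFilter F)
    (hl : ∀ n, ∃ α : D.FinPath, n ≤ α.edges.length ∧ idem α ∈ F) : IsTight F := by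
  intro X Y Z hX hY hZ hXF hYF hc
  obtain ⟨N, hN⟩ := (((hX.union hY).union hZ).image sourceLength).bddAbove
  obtain ⟨α, hα, hαF⟩ := hl N
  have hlen : ∀ β : D.FinPath, idem β ∈ X ∪ Y ∪ Z → β.edges.length ≤ α.edges.length :=
    fun β hβ => (hN ⟨_, hβ, sourceLength_idem β⟩).trans hα
  -- As `α` is at least as long as every path occurring in `X`, `Y`, `Z`, such a path is either a
  -- prefix of `α` or orthogonal to it.
  have hpre : ∀ β : D.FinPath, idem β ∈ X ∪ Y ∪ Z → idem β * idem α ≠ 0 → idem β ∈ F := by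
    intro β hβ h
    rcases isPrefix_or_isPrefix h with h | h
    · exact idem_mem_of_isPrefix hF h hαF
    · rwa [← h.eq_of_length_le (hlen β hβ)]
  -- So the cover has a member that meets `α`; by `hpre` that member lies in `F`.
  have hmem : idem α ∈ between X Y := by
    refine ⟨isIdempotentElem_idem α, fun x hx => ?_, fun y hy => ?_⟩
    · obtain ⟨β, rfl⟩ := exists_idem_of_mem hF (hXF hx)
      exact idem_mul_of_isPrefix (isPrefix_of_mem hF (hXF hx) hαF (hlen β (.inl (.inl hx))))
    · by_cases h0 : y = 0
      · rw [h0, mul_zero]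
      · obtain ⟨β, rfl⟩ := eq_idem_of_isIdempotentElem (hYF y hy).1 h0
        rw [idem_mul_comm]
        by_contra h
        exact (hYF _ hy).2 (hpre β (.inl (.inr hy)) h)
  obtain ⟨z, hz, hne⟩ := hc.2 _ hmem (idem_ne_zero α)
  refine ⟨z, hz, ?_⟩
  obtain ⟨β, rfl⟩ := eq_idem_of_isIdempotentElem (hc.1 hz).1 fun h => hne (by rw [h, zero_mul])
  exact hpre β (.inr hz) hne

/-- If each path with property `P` has a proper extension with property `P`, then each
path with property `P` lies on a tight filter containing arbitrarily long paths
with property `P`. -/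
theorem exists_tightFilter (P : D.FinPath → Prop)
    (hP : ∀ α, P α → ∃ β, P β ∧ α.IsPrefix β ∧ α.edges.length < β.edges.length)
    {α : D.FinPath} (hα : P α) :
    ∃ F : TightFilter D.InvSemigroup, idem α ∈ F ∧
      ∀ n, ∃ β : D.FinPath, n ≤ β.edges.length ∧ P β ∧ idem β ∈ F := by
  -- `f` is controlled only on paths with property `P`; `hPξ` keeps the iterates among them.
  choose! f hf1 hf2 hf3 using hP
  let ξ : ℕ → D.FinPath := fun n => f^[n] α
  have hs : ∀ n, ξ (n + 1) = f (ξ n) := fun n => Function.iterate_succ_apply' f n α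
  have hPξ : ∀ n, P (ξ n) := fun n => by
    induction n with
    | zero => exact hα
    | succ n ih => rw [hs]; exact hf1 _ ih
  have hmono : ∀ m n, m ≤ n → (ξ m).IsPrefix (ξ n) := fun m n h => by
    induction n, h using Nat.le_induction with
    | base => exact .refl _
    | succ n _ ih => rw [hs]; exact ih.trans (hf2 _ (hPξ n))
  have hlen : ∀ n, n ≤ (ξ n).edges.length := fun n => by
    induction n with
    | zero => exact Nat.zero_le _
    | succ n ih => rw [hs]; exact ih.trans_lt (hf3 _ (hPξ n))
  let F : Set D.InvSemigroup := {e | ∃ (β : D.FinPath) (n : ℕ), e = idem β ∧ β.IsPrefix (ξ n)}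
  have hξF : ∀ n, idem (ξ n) ∈ F := fun n => ⟨_, n, rfl, .refl _⟩
  have hF : IsFilter F := by
    refine ⟨?_, ⟨_, hξF 0⟩, ?_, ?_, ?_⟩
    · rintro _ ⟨β, n, rfl, -⟩
      exact isIdempotentElem_idem β
    · rintro ⟨β, n, h, -⟩
      exact idem_ne_zero β h.symm
    · rintro _ ⟨β, m, rfl, hm⟩ _ ⟨γ, n, rfl, hn⟩
      have hm' := hm.trans (hmono _ _ (le_max_left m n))
      have hn' := hn.trans (hmono _ _ (le_max_right m n))
      rcases le_total β.edges.length γ.edges.length with h | h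
      · rw [idem_mul_comm,
          idem_mul_of_isPrefix (DirectedGraph.Path.isPrefix_of_length_le hm' hn' h)]
        exact ⟨γ, n, rfl, hn⟩
      · rw [idem_mul_of_isPrefix (DirectedGraph.Path.isPrefix_of_length_le hn' hm' h)]
        exact ⟨β, m, rfl, hm⟩
    · rintro _ ⟨β, n, rfl, hn⟩ e he hle
      have h0 : e ≠ 0 := by
        rintro rfl
        rw [mul_zero] at hle
        exact idem_ne_zero β hle.symm
      obtain ⟨γ, rfl⟩ := eq_idem_of_isIdempotentElem he h0
      exact ⟨γ, n, rfl, (isPrefix_of_idem_mul hle).trans hn⟩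
  exact ⟨⟨F, hF, isTight_of_unbounded hF fun n => ⟨ξ n, hlen n, hξF n⟩⟩, hξF 0,
    fun n => ⟨ξ n, hlen n, hPξ n, hξF n⟩⟩

/-- Without sources every path can be prolonged by an edge, so `exists_tightFilter` applies with the
trivial property. -/
theorem exists_tightFilter_mem (no_sources : ∀ x : V, ∃ e : Ed, D.r e = x) (α : D.FinPath) :
    ∃ F : TightFilter D.InvSemigroup, idem α ∈ F := by
  obtain ⟨F, hF, -⟩ := exists_tightFilter (fun _ => True) (α := α) (fun β _ => by
    obtain ⟨e, he⟩ := no_sources β.src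
    exact ⟨β.snoc e he.symm, trivial, β.isPrefix_snoc e _, by
      rw [DirectedGraph.Path.length_snoc]; exact Nat.lt_succ_self _⟩) trivial
  exact ⟨F, hF⟩

end Filters

/-! ### Comparing germs at one filter -/

/-- A germ at a filter containing `(β, 1, β)`, with a representative `(α, g, β₀)` such that `β₀` is
a prefix of `β`, has a representative of the form `(α', g', β)`. -/
theorem exists_germ_triple {F : TightFilter D.InvSemigroup} {α : D.FinPath} {g : G}
    {β₀ β : D.FinPath} {hs : α.src = g • β₀.src} (h : F ∈ dom (triple α g β₀ hs))
    (hβ : idem β ∈ F) (hp : β₀.IsPrefix β) :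
    ∃ (α' : D.FinPath) (g' : G) (hs' : α'.src = g' • β.src) (h' : F ∈ dom (triple α' g' β hs')),
      germ (triple α g β₀ hs) F h = germ (triple α' g' β hs') F h' := by
  obtain ⟨α', g', hs', e⟩ := triple_mul_idem α g hs hp
  refine ⟨α', g', hs', ?_, ?_⟩
  · rw [dom, Set.mem_ofPred_eq, star_mul_triple]
    exact hβ
  · refine (germ_eq_germ_iff _ _).2 ⟨rfl, idem β, isIdempotentElem_idem β, hβ, ?_⟩
    rw [← e, mul_assoc, (isIdempotentElem_idem β).eq]

theorem mem_dom_triple {F : TightFilter D.InvSemigroup} {α : D.FinPath} {g : G}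
    {β : D.FinPath} {hs : α.src = g • β.src} : F ∈ dom (triple α g β hs) ↔ idem β ∈ F := by
  rw [dom, Set.mem_ofPred_eq, star_mul_triple]

/-- Two germs at the same filter have representatives with a common last entry. -/
theorem exists_common_germ_triple {s t : D.InvSemigroup} {F : TightFilter D.InvSemigroup}
    (hs : F ∈ dom s) (ht : F ∈ dom t) :
    ∃ (α α' β : D.FinPath) (g g' : G) (h : α.src = g • β.src) (h' : α'.src = g' • β.src)
      (hd : F ∈ dom (triple α g β h)) (hd' : F ∈ dom (triple α' g' β h')),
      germ s F hs = germ (triple α g β h) F hd ∧ germ t F ht = germ (triple α' g' β h') F hd' := by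
  cases s with
  | zero => exact (F.isFilter.zero_notMem hs).elim
  | triple α g β h =>
    cases t with
    | zero => exact (F.isFilter.zero_notMem ht).elim
    | triple γ k δ h' =>
      rcases isPrefix_or_isPrefix_of_mem F.isFilter (mem_dom_triple.1 hs) (mem_dom_triple.1 ht)
        with hp | hp
      · obtain ⟨α', g', hs', hd, e⟩ := exists_germ_triple hs (mem_dom_triple.1 ht) hp
        exact ⟨α', γ, δ, g', k, hs', h', hd, ht, e, rfl⟩
      · obtain ⟨α', g', hs', hd, e⟩ := exists_germ_triple ht (mem_dom_triple.1 hs) hp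
        exact ⟨α, α', β, g, g', h, hs', hs, hd, rfl, e⟩

/-- On the domain of two triples with the same last entry, the set of agreement is
empty or the union of the cylinder sets of the minimal strongly fixed paths. -/
theorem mem_agree_iff {α α' β : D.FinPath} {g g' : G} (h : α.src = g • β.src)
    (h' : α'.src = g' • β.src) {F : TightFilter D.InvSemigroup} (hF : idem β ∈ F) :
    F ∈ agree (triple α g β h) (triple α' g' β h') ↔
      α = α' ∧ ∃ μ : D.FinPath, D.MinimalStronglyFixed (g'⁻¹ * g) μ ∧
        ∃ hμ : β.src = μ.rng, idem (β.comp μ hμ) ∈ F := by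
  constructor
  · rintro ⟨e, he, heF, heq⟩
    -- The witness `e` may be shrunk to its product with `(β, 1, β)`, so that it comes from an
    -- extension `βμ`.
    obtain ⟨γ, hγ⟩ := exists_idem_of_mem F.isFilter (F.isFilter.mul_mem _ heF _ hF)
    have hγF : idem γ ∈ F := hγ ▸ F.isFilter.mul_mem _ heF _ hF
    have hle : idem γ * idem β = idem γ := by
      rw [← hγ, mul_assoc, (isIdempotentElem_idem β).eq]
    obtain ⟨μ, hμ, rfl⟩ := isPrefix_of_idem_mul hle
    have key : triple α g β h * idem (β.comp μ hμ) = triple α' g' β h' * idem (β.comp μ hμ) := by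
      rw [← hγ, ← mul_assoc, heq, mul_assoc]
    rw [triple_mul_idem_eq_iff] at key
    obtain ⟨ν, hν, hmin⟩ := key.2.exists_minimal
    have hr := DirectedGraph.Path.rng_eq_of_isPrefix hν
    refine ⟨key.1, ν, hmin, hμ.trans hr.symm, idem_mem_of_isPrefix F.isFilter ?_ hγF⟩
    rw [DirectedGraph.Path.isPrefix_iff] at hν ⊢
    exact ⟨rfl, (List.prefix_append_right_inj _).2 hν.2⟩
  · rintro ⟨e, μ, hmin, hμ, hm⟩
    exact ⟨_, isIdempotentElem_idem _, hm, (triple_mul_idem_eq_iff h h' μ hμ).2 ⟨e, hmin.1⟩⟩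

end InvSemigroup

/-! ### Finitely many minimal strongly fixed paths imply Hausdorff -/

theorem t2Space_tightGroupoid
    (hfin : ∀ g : G, {α : D.FinPath | D.MinimalStronglyFixed g α}.Finite) :
    T2Space (TightGroupoid D.InvSemigroup) := by
  refine ⟨fun u v huv => ?_⟩
  by_cases hb : u.base = v.base
  · obtain ⟨s, F, hs, rfl⟩ := exists_germ u
    obtain ⟨t, F', ht, rfl⟩ := exists_germ v
    obtain rfl : F = F' := hb
    obtain ⟨α, α', β, g, g', h, h', hd, hd', e, e'⟩ := exists_common_germ_triple hs ht
    rw [e, e'] at huv ⊢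
    have hβ := mem_dom_triple.1 hd
    have hna : F ∉ agree (triple α g β h) (triple α' g' β h') := fun ha =>
      huv ((germ_eq_germ_iff _ _).2 ⟨rfl, ha⟩)
    refine separate_germ hd hd' ?_
    by_cases hα : α = α'
    -- The cylinder of `β` minus the cylinders of all `βμ`; it is open because there are finitely
    -- many `μ`. Those with `r(μ) ≠ d(β)` impose no condition.
    · refine ⟨{F | idem β ∈ F} ∩ ⋂ μ ∈ {μ | D.MinimalStronglyFixed (g'⁻¹ * g) μ},
        ⋂ hμ : β.src = μ.rng, {F | idem (β.comp μ hμ) ∉ F}, ?_, ⟨hβ, ?_⟩, ?_⟩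
      · exact (TightFilter.isOpen_setOf_mem _).inter <| (hfin _).isOpen_biInter fun μ _ =>
          isOpen_iInter_of_finite fun _ => TightFilter.isOpen_setOf_notMem _
      · simp only [Set.mem_iInter]
        exact fun μ hmin hμ hm => hna ((mem_agree_iff h h' hβ).2 ⟨hα, μ, hmin, hμ, hm⟩)
      · refine Set.disjoint_left.2 fun F' hF' ha => ?_
        obtain ⟨-, μ, hmin, hμ, hm⟩ := (mem_agree_iff h h' hF'.1).1 ha
        have := hF'.2
        simp only [Set.mem_iInter] at this
        exact this μ hmin hμ hm
    · exact ⟨{F | idem β ∈ F}, TightFilter.isOpen_setOf_mem _, hβ,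
        Set.disjoint_left.2 fun F' hF' ha => hα ((mem_agree_iff h h' hF').1 ha).1⟩
  · exact separated_by_continuous TightGroupoid.continuous_base hb

/-! ### Hausdorff implies finitely many minimal strongly fixed paths -/

/-- An infinite set of finite paths in a graph with finitely many vertices contains, for some
vertex, infinitely many paths with that range. -/
theorem exists_vertex_infinite [Finite V] {M : Set D.FinPath} (hM : M.Infinite) :
    ∃ α : D.FinPath, α.edges = [] ∧ {μ ∈ M | α.IsPrefix μ}.Infinite := by
  by_contra! hc
  refine hM (Set.Finite.subset (Set.finite_iUnion fun x : V =>
    hc ⟨x, [], trivial⟩ rfl) fun μ hμ => Set.mem_iUnion.2 ⟨μ.rng, hμ, ?_⟩)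
  exact (DirectedGraph.Path.isPrefix_iff _ _).2 ⟨rfl, List.nil_prefix⟩

/-- Pigeonhole step of König's lemma: a path extending `α` is `α` itself or extends `αe` for one of
finitely many edges `e`. -/
theorem exists_longer_infinite [Finite Ed] {M : Set D.FinPath} (α : D.FinPath)
    (hM : {μ ∈ M | α.IsPrefix μ}.Infinite) :
    ∃ β : D.FinPath, {μ ∈ M | β.IsPrefix μ}.Infinite ∧ α.IsPrefix β ∧
      α.edges.length < β.edges.length := by
  by_contra! hc
  have hfin : ∀ e : {e : Ed // α.src = D.r e}, {μ ∈ M | (α.snoc e.1 e.2).IsPrefix μ}.Finite :=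
    fun e => by
      by_contra hi
      have := hc _ hi (α.isPrefix_snoc e.1 e.2)
      rw [DirectedGraph.Path.length_snoc] at this
      omega
  refine hM (((Set.finite_singleton α).union (Set.finite_iUnion hfin)).subset ?_)
  rintro μ ⟨hμ, hp⟩
  by_cases h : μ = α
  · exact .inl h
  · obtain ⟨e, he, hp'⟩ := hp.exists_snoc h
    exact .inr (Set.mem_iUnion.2 ⟨⟨e, he⟩, hμ, hp'⟩)

theorem finite_minimalStronglyFixed [Finite V] [Finite Ed]
    (no_sources : ∀ x : V, ∃ e : Ed, D.r e = x) [T2Space (TightGroupoid D.InvSemigroup)] (g : G) :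
    {α : D.FinPath | D.MinimalStronglyFixed g α}.Finite := by
  by_contra hM
  set M := {α : D.FinPath | D.MinimalStronglyFixed g α}
  obtain ⟨ν, hν, hνM⟩ := exists_vertex_infinite hM
  -- `φ(g, μ) = 1` acts on vertices as `g` does, so `g` fixes every vertex and `(ν, g, ν)` is a
  -- legitimate triple.
  have hx : ν.src = g • ν.src := by
    obtain ⟨μ, hμ, -⟩ := hνM.nonempty
    rw [← D.coc_smul g μ, hμ.1.2, one_smul]
  have hνrng : ν.src = ν.rng := by rw [DirectedGraph.Path.src, hν]; rfl
  obtain ⟨F, hνF, hF⟩ := exists_tightFilter (fun α => {μ ∈ M | α.IsPrefix μ}.Infinite)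
    exists_longer_infinite hνM
  choose β hβl hβM hβF using hF
  choose μ hμM hβμ using fun n => (hβM n).nonempty
  choose u hu using fun n => exists_tightFilter_mem no_sources (μ n)
  have hlim : Tendsto u atTop (𝓝 F) := by
    refine TightFilter.tendsto_iff.2 fun e => ?_
    filter_upwards [eventually_ge_atTop (sourceLength e)] with n hn
    have hβu : idem (β n) ∈ u n := idem_mem_of_isPrefix (u n).isFilter (hβμ n) (hu n)
    -- For `n` at least the length of `e`, all filters containing the long path `β n` agree on
    -- whether `e` belongs to them.
    have key : ∀ F₁ F₂ : TightFilter D.InvSemigroup, idem (β n) ∈ F₁ → idem (β n) ∈ F₂ →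
        e ∈ F₁ → e ∈ F₂ := by
      intro F₁ F₂ h₁ h₂ he
      obtain ⟨γ, rfl⟩ := exists_idem_of_mem F₁.isFilter he
      exact idem_mem_of_isPrefix F₂.isFilter
        (isPrefix_of_mem F₁.isFilter he h₁ (hn.trans (hβl n))) h₂
    exact ⟨key _ _ hβu (hβF n), key _ _ (hβF n) hβu⟩
  have hνμ : ∀ n, ν.IsPrefix (μ n) := fun n =>
    (isPrefix_of_mem F.isFilter hνF (hβF n) (by rw [hν]; exact Nat.zero_le _)).trans (hβμ n)
  have hνu : ∀ n, idem ν ∈ u n := fun n => idem_mem_of_isPrefix (u n).isFilter (hνμ n) (hu n)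
  let s : D.InvSemigroup := triple ν g ν hx
  let t : D.InvSemigroup := triple ν 1 ν (one_smul _ _).symm
  have hs : ∀ {F' : TightFilter D.InvSemigroup}, idem ν ∈ F' → F' ∈ dom s := mem_dom_triple.2
  have ht : ∀ {F' : TightFilter D.InvSemigroup}, idem ν ∈ F' → F' ∈ dom t := mem_dom_triple.2
  have hls : Tendsto (fun n => germ s (u n) (hs (hνu n))) atTop (𝓝 (germ s F (hs hνF))) :=
    ((continuous_germ s).tendsto ⟨F, hs hνF⟩).comp
      (tendsto_subtype_rng.2 hlim : Tendsto (fun n => (⟨u n, hs (hνu n)⟩ : dom s)) _ _)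
  have hlt : Tendsto (fun n => germ t (u n) (ht (hνu n))) atTop (𝓝 (germ t F (ht hνF))) :=
    ((continuous_germ t).tendsto ⟨F, ht hνF⟩).comp
      (tendsto_subtype_rng.2 hlim : Tendsto (fun n => (⟨u n, ht (hνu n)⟩ : dom t)) _ _)
  have hcomp : ∀ (γ : D.FinPath) (hγ : ν.src = γ.rng), ν.comp γ hγ = γ := fun γ hγ =>
    DirectedGraph.Path.ext (hνrng.symm.trans hγ) (by simp [DirectedGraph.Path.comp, hν])
  have heq : ∀ n, germ s (u n) (hs (hνu n)) = germ t (u n) (ht (hνu n)) := fun n => by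
    have hr := hνrng.trans (DirectedGraph.Path.rng_eq_of_isPrefix (hνμ n))
    refine (germ_eq_germ_iff _ _).2 ⟨rfl, (mem_agree_iff _ _ (hνu n)).2
      ⟨rfl, μ n, by rw [inv_one, one_mul]; exact hμM n, hr, ?_⟩⟩
    rw [hcomp]
    exact hu n
  -- The one use of the Hausdorff hypothesis: a single sequence of germs has both limits.
  have hgerm := tendsto_nhds_unique (hls.congr heq) hlt
  obtain ⟨-, γ, hγ, hr, hγF⟩ := (mem_agree_iff _ _ hνF).1 ((germ_eq_germ_iff _ _).1 hgerm).2
  rw [hcomp] at hγF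
  rw [inv_one, one_mul] at hγ
  have hγβ := isPrefix_of_mem F.isFilter hγF (hβF _) (hβl _)
  -- `β` at index `|γ|` is long enough to extend `γ`. By minimality its only possible extension
  -- among the minimal strongly fixed paths is `γ`, yet there are infinitely many.
  refine hβM γ.edges.length ((Set.finite_singleton γ).subset ?_)
  rintro δ ⟨hδ, hp⟩
  by_contra hne
  exact hδ.2 γ (hγβ.trans hp) (Ne.symm hne) hγ.1

end SelfSimilarGraph

/-- Let `G` be a countable group acting on a finite graph without sources, with a one-cocycle `φ`
as in `SelfSimilarGraph`. Every `g : G` has at most finitely many minimal strongly fixed paths if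
and only if the tight groupoid of the associated inverse semigroup is Hausdorff. -/
theorem theorem12p2 {G V Ed : Type*} [Group G] [Countable G] [Finite V] [Finite Ed]
    [MulAction G V] [MulAction G Ed] (D : SelfSimilarGraph G V Ed)
    (no_sources : ∀ x : V, ∃ e : Ed, D.r e = x) :
    (∀ g : G, {α : D.FinPath | D.MinimalStronglyFixed g α}.Finite) ↔
      T2Space (InverseSemigroupWithZero.TightGroupoid D.InvSemigroup) :=
  ⟨fun h => SelfSimilarGraph.t2Space_tightGroupoid h,
    fun _ => SelfSimilarGraph.finite_minimalStronglyFixed no_sources⟩
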